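/- A hypergraph here consists of finite sets of vertices, hyperedges and hinges, where every hinge attaches one hyperedge to one vertex and every hyperedge has at least one hinge; the degree of a vertex is the number of hinges at it. Let $n\ge 3$ and $\lambda\ge 1$ be integers, and let $K_n^3$ be the complete $3$-uniform hypergraph on $n$ vertices: every hyperedge has exactly three hinges, at three distinct vertices, and every three distinct vertices are joined by exactly one hyperedge. Let $\lambda K_n^3$ be the multi-hypergraph obtained from $K_n^3$ by replacing each hyperedge by $\lambda$ copies of it. For positive integers $r_1,\dots,r_k$ (not necessarily distinct), an $(r_1,\dots,r_k)$-factorization of a hypergraph $G$ is a partition of its set of hyperedges into classes $P_1,\dots,P_k$ such that, for each $i$, the spanning sub-hypergraph of $G$ with hyperedge set $P_i$ is $r_i$-regular, i.e. each of its vertices has degree $r_i$. **Theorem.** Let $n\ge 3$ and $\lambda\ge 1$, and let $r_1,\dots,r_k$ be positive integers. Then $\lambda K_n^3$ has an $(r_1,\dots,r_k)$-factorization if and only if 1. $3$ divides $r_i n$ for each $i$, $1\le i\le k$, and 2. $\displaystyle\sum_{i=1}^k r_i=\lambda\binom{n-1}{2}$. -/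

import Mathlib

/-- A hypergraph, possibly with loops and multiple hyperedges: a finite type `V` of vertices, a
finite type `E` of hyperedges and a finite type `H` of hinges, where the hinge `h` attaches the
hyperedge `φ h` to the vertex `ψ h`, and every hyperedge has at least one hinge. -/
structure HingeHypergraph (V E H : Type*) [Finite V] [Finite E] [Finite H] where
  ψ : H → V
  φ : H → E
  φ_surjective : Function.Surjective φ

namespace HingeHypergraph

variable {V E H : Type*} [Finite V] [Finite E] [Finite H]

/-- The hinges incident with the hyperedge `e`. -/
def hinges (G : HingeHypergraph V E H) (e : E) : Set H := {h | G.φ h = e}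

/-- The vertices incident with the hyperedge `e`. -/
def edgeVertices (G : HingeHypergraph V E H) (e : E) : Set V := G.ψ '' G.hinges e

/-- The degree of a vertex: the number of hinges incident with it. -/
noncomputable def degree (G : HingeHypergraph V E H) (v : V) : ℕ := {h | G.ψ h = v}.ncard

/-- Every vertex has degree `d`. -/
def IsRegular (G : HingeHypergraph V E H) (d : ℕ) : Prop := ∀ v, G.degree v = d

/-- Every hyperedge is incident with exactly `k` vertices and with exactly `k` hinges. -/
def IsUniform (G : HingeHypergraph V E H) (k : ℕ) : Prop :=
  ∀ e, (G.edgeVertices e).ncard = k ∧ (G.hinges e).ncard = k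

/-- `G` is a complete `k`-uniform hypergraph `K_n^k`: it is `k`-uniform with `n` vertices, and
every `k` distinct vertices are joined by exactly one hyperedge. -/
def IsComplete (G : HingeHypergraph V E H) (k n : ℕ) : Prop :=
  G.IsUniform k ∧ Nat.card V = n ∧ ∀ s : Set V, s.ncard = k → ∃! e, G.edgeVertices e = s

/-- The hypergraph `lam G`, in which every hyperedge of `G` is replaced by `lam` multiple
hyperedges (each with its own copy of the hinges). -/
def multiple (lam : ℕ) (G : HingeHypergraph V E H) :
    HingeHypergraph V (E × Fin lam) (H × Fin lam) where
  ψ h := G.ψ h.1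
  φ h := (G.φ h.1, h.2)
  φ_surjective := fun ⟨e, j⟩ => by
    obtain ⟨h, rfl⟩ := G.φ_surjective e
    exact ⟨(h, j), rfl⟩

/-- The spanning sub-hypergraph of `G` with hyperedge set `S`: all the vertices of `G`, the
hyperedges in `S`, and all the hinges incident with these hyperedges. -/
def spanningSub (G : HingeHypergraph V E H) (S : Set E) :
    HingeHypergraph V S {h : H // G.φ h ∈ S} where
  ψ h := G.ψ h.1
  φ h := ⟨G.φ h.1, h.2⟩
  φ_surjective := fun ⟨e, he⟩ => by
    obtain ⟨h, rfl⟩ := G.φ_surjective e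
    exact ⟨⟨h, he⟩, rfl⟩

/-- The hyperedges in `S` form an `r`-factor of `G`: an `r`-regular spanning sub-hypergraph. -/
def IsFactor (G : HingeHypergraph V E H) (r : ℕ) (S : Set E) : Prop :=
  (G.spanningSub S).IsRegular r

/-- `G` has an `(r₁, …, r_k)`-factorization: its hyperedge set is partitioned into
`P 0, …, P (k - 1)`, where `P i` is an `r i`-factor. -/
def IsFactorizable (G : HingeHypergraph V E H) {k : ℕ} (r : Fin k → ℕ) : Prop :=
  ∃ P : Fin k → Set E, Pairwise (fun i j => Disjoint (P i) (P j)) ∧ (⋃ i, P i) = Set.univ ∧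
    ∀ i, G.IsFactor (r i) (P i)

end HingeHypergraph

/-!
Necessity is double counting: an `r`-regular `3`-uniform hypergraph on `n` vertices with `m`
hyperedges satisfies `3 m = r n` (`card_mul_of_regular`), and a vertex of `lam K_n^3` has degree
`lam * (n - 1).choose 2` (`card_subtype_mem`).

Sufficiency is a Baranyai-type argument in the style of Brouwer and Schrijver. Take a set `X` of
hyperedge tokens, `r i * n / 3` of them with colour `i`, and let the vertices join the hyperedges one
at a time. After the vertices of `U` are treated, every token `x` has a trace `T x ⊆ U`, and the
invariant (`exists_traces`) says that each vertex of `U` lies in `r i` traces of colour `i`, and that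
each `S ⊆ U` with `|S| ≤ 3` is a trace exactly as often as in `lam K_n^3`, namely
`lam * (n - |U|).choose (3 - |S|)` times. When `U` is everything, the tokens with their traces
are a coloured copy of `lam K_n^3`, and the colour classes are the required factors.

To add a vertex `v`, put `v` into `x` with the fractional amount `(3 - |T x|) / (n - |U|)`. These
amounts add up to the required integer over each colour and over each trace, so it is enough to
round them to `0` and `1` while keeping the sums over the classes of two partitions of `X`
(`exists_finset_card_fibers_eq`). That is integrality of a transportation problem with unit
capacities, which is derived here from Hall's theorem through a doubly stochastic matrix.
-/

/-! ### Rounding with prescribed sums over two partitions -/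

/-- The support of a doubly stochastic matrix contains a perfect matching; the rows and the columns
may be indexed by different types. -/
theorem exists_bijective_ne_zero {L R : Type*} [Fintype L] [Fintype R] (M : L → R → ℚ)
    (hM : ∀ l r, 0 ≤ M l r) (hrow : ∀ l, ∑ r, M l r = 1) (hcol : ∀ r, ∑ l, M l r = 1) :
    ∃ f : L → R, Function.Bijective f ∧ ∀ l, M l (f l) ≠ 0 := by
  classical
  have hcard : Fintype.card L = Fintype.card R := by
    have h : ∑ l, ∑ r, M l r = ∑ r, ∑ l, M l r := Finset.sum_comm
    simp only [hrow, hcol, Finset.sum_const, Finset.card_univ, nsmul_eq_mul, mul_one] at h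
    exact_mod_cast h
  obtain ⟨f, hinj, hf⟩ := (Finset.all_card_le_biUnion_card_iff_exists_injective
    (fun l => Finset.univ.filter fun r => M l r ≠ 0)).1 (by
      intro A
      set N := A.biUnion fun l => Finset.univ.filter fun r => M l r ≠ 0 with hN
      have h1 : ∀ l ∈ A, ∑ r ∈ N, M l r = 1 := by
        intro l hl
        rw [← hrow l]
        refine Finset.sum_subset (Finset.subset_univ _) fun r _ hr => ?_
        by_contra h0
        exact hr (Finset.mem_biUnion.2 ⟨l, hl, by simpa using h0⟩)
      have h2 : (A.card : ℚ) ≤ N.card := by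
        calc (A.card : ℚ) = ∑ l ∈ A, ∑ r ∈ N, M l r := by simp [Finset.sum_congr rfl h1]
          _ = ∑ r ∈ N, ∑ l ∈ A, M l r := Finset.sum_comm
          _ ≤ ∑ r ∈ N, ∑ l, M l r := Finset.sum_le_sum fun r _ =>
            Finset.sum_le_univ_sum_of_nonneg fun l => hM l r
          _ = N.card := by simp [hcol]
      exact_mod_cast h2)
  exact ⟨f, (Fintype.bijective_iff_injective_and_card f).2 ⟨hinj, hcard⟩,
    fun l => by simpa using hf l⟩

theorem eq_zero_of_sum_fiber_eq_zero {X K : Type*} [Fintype X] [DecidableEq K] (γ : X → K)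
    (w : X → ℚ) (hw : ∀ x, 0 ≤ w x) {x : X} (h : ∑ y with γ y = γ x, w y = 0) : w x = 0 :=
  (Finset.sum_eq_zero_iff_of_nonneg fun _ _ => hw _).1 h x (by simp)

/-- Weights in `[0, 1]` whose sums over the fibres of `α` and of `β` are integers can be rounded to
the indicator of a finset without changing any of these sums.

View `x` as an edge from `α x` to `β x`, and subdivide it by two nodes, a column `inr x` and a row
`inr x`. The rows are these together with `a i` slots for each `i`, and the columns are these
together with `b j` slots for each `j`. In a perfect matching either the two nodes of `x` are
matched to each other, and `x` is left out, or they are matched to a slot of `α x` and to a slot of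
`β x`, and `x` is taken. -/
theorem exists_finset_card_fibers_eq {X I J : Type*} [Fintype X] [DecidableEq X] [Fintype I]
    [Fintype J] [DecidableEq I] [DecidableEq J] (α : X → I) (β : X → J) (w : X → ℚ)
    (hw0 : ∀ x, 0 ≤ w x) (hw1 : ∀ x, w x ≤ 1) (a : I → ℕ) (b : J → ℕ)
    (ha : ∀ i, ∑ x with α x = i, w x = a i) (hb : ∀ j, ∑ x with β x = j, w x = b j) :
    ∃ F : Finset X, (∀ i, {x ∈ F | α x = i}.card = a i) ∧
      ∀ j, {x ∈ F | β x = j}.card = b j := by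
  let M : (Σ i, Fin (a i)) ⊕ X → (Σ j, Fin (b j)) ⊕ X → ℚ
    | .inl _, .inl _ => 0
    | .inl p, .inr x => if α x = p.1 then w x / a p.1 else 0
    | .inr x, .inr y => if y = x then 1 - w x else 0
    | .inr x, .inl q => if β x = q.1 then w x / b q.1 else 0
  obtain ⟨f, hf, hfM⟩ := exists_bijective_ne_zero M
    (by
      rintro (p | x) (q | y) <;> simp only [M]
      · exact le_rfl
      · split_ifs
        exacts [div_nonneg (hw0 _) (Nat.cast_nonneg _), le_rfl]
      · split_ifs
        exacts [div_nonneg (hw0 _) (Nat.cast_nonneg _), le_rfl]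
      · split_ifs
        exacts [sub_nonneg.2 (hw1 _), le_rfl])
    (by
      rintro (⟨i, s⟩ | x)
      · have : (a i : ℚ) ≠ 0 := by have := s.pos; positivity
        simp [M, Fintype.sum_sum_type, ← Finset.sum_filter, ← Finset.sum_div, ha, this]
      · have h : (b (β x) : ℚ) * (w x / b (β x)) = w x := by
          by_cases h0 : (b (β x) : ℚ) = 0
          · simp [h0, eq_zero_of_sum_fiber_eq_zero β w hw0 ((hb (β x)).trans h0)]
          · field_simp
        simp [M, Fintype.sum_sum_type, Fintype.sum_sigma, h])
    (by
      rintro (⟨j, s⟩ | x)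
      · have : (b j : ℚ) ≠ 0 := by have := s.pos; positivity
        simp [M, Fintype.sum_sum_type, ← Finset.sum_filter, ← Finset.sum_div, hb, this]
      · have h : (a (α x) : ℚ) * (w x / a (α x)) = w x := by
          by_cases h0 : (a (α x) : ℚ) = 0
          · simp [h0, eq_zero_of_sum_fiber_eq_zero α w hw0 ((ha (α x)).trans h0)]
          · field_simp
        simp [M, Fintype.sum_sum_type, Fintype.sum_sigma, h])
  -- A slot of `i` is matched to some `x` with `α x = i`.
  have hl : ∀ p, ∃ x, f (.inl p) = .inr x ∧ α x = p.1 := by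
    intro p
    have h := hfM (.inl p)
    rcases hq : f (.inl p) with q | x
    · simp [M, hq] at h
    · refine ⟨x, rfl, ?_⟩
      by_contra h0
      simp [M, hq, h0] at h
  -- The row node of `x` is matched to the column node of `x` or to a slot of `β x`.
  have hr : ∀ x, f (.inr x) = .inr x ∨ ∃ s, f (.inr x) = .inl ⟨β x, s⟩ := by
    intro x
    have h := hfM (.inr x)
    rcases hq : f (.inr x) with ⟨j, s⟩ | y
    · by_cases h0 : β x = j
      · subst h0; exact .inr ⟨s, rfl⟩
      · simp [M, hq, h0] at h
    · left
      by_contra h0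
      simp only [M, hq, ne_eq, ite_eq_right_iff, not_forall] at h
      exact h0 (congrArg Sum.inr h.1)
  refine ⟨Finset.univ.filter fun x => f (.inr x) ≠ .inr x, fun i => ?_, fun j => ?_⟩
  · choose g hg hgα using hl
    refine Eq.trans (Eq.symm ?_) (Fintype.card_fin (a i))
    refine Finset.card_bij (fun s _ => g ⟨i, s⟩) ?_ ?_ ?_
    · intro s _
      simp only [Finset.mem_filter, Finset.mem_univ, true_and]
      exact ⟨fun h => Sum.inr_ne_inl (hf.1 (h.trans (hg _).symm)), hgα _⟩
    · intro s _ t _ h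
      have h' := hf.1 ((hg ⟨i, s⟩).trans ((congrArg Sum.inr h).trans (hg ⟨i, t⟩).symm))
      simpa using h'
    · intro x hx
      simp only [Finset.mem_filter, Finset.mem_univ, true_and] at hx
      obtain ⟨p | y, hy⟩ := hf.2 (.inr x)
      · have h : g p = x := Sum.inr_injective ((hg p).symm.trans hy)
        obtain ⟨i', s⟩ := p
        have : i' = i := by rw [← hx.2, ← h, hgα]
        subst this
        exact ⟨s, Finset.mem_univ _, h⟩
      · rcases hr y with h | ⟨s, h⟩
        · rw [h] at hy
          cases hy
          exact absurd h hx.1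
        · rw [h] at hy
          cases hy
  · refine Eq.trans (Eq.symm ?_) (Fintype.card_fin (b j))
    have hp : ∀ s : Fin (b j), ∃ x, f (.inr x) = .inl ⟨j, s⟩ ∧ β x = j := by
      intro s
      obtain ⟨p | y, hy⟩ := hf.2 (.inl ⟨j, s⟩)
      · obtain ⟨x, hx, -⟩ := hl p
        rw [hx] at hy
        cases hy
      · refine ⟨y, hy, ?_⟩
        rcases hr y with h | ⟨t, h⟩
        · rw [h] at hy
          cases hy
        · rw [h] at hy
          exact congrArg Sigma.fst (Sum.inl_injective hy)
    choose g hg hgβ using hp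
    refine Finset.card_bij (fun s _ => g s) ?_ ?_ ?_
    · intro s _
      simp only [Finset.mem_filter, Finset.mem_univ, true_and]
      exact ⟨by rw [hg]; exact Sum.inl_ne_inr, hgβ s⟩
    · intro s _ t _ h
      have h' := (hg s).symm.trans ((congrArg (fun x => f (.inr x)) h).trans (hg t))
      simpa using h'
    · intro x hx
      simp only [Finset.mem_filter, Finset.mem_univ, true_and] at hx
      obtain ⟨h1, rfl⟩ := hx
      rcases hr x with h | ⟨s, h⟩
      · exact absurd h h1
      · exact ⟨s, Finset.mem_univ _, Sum.inr_injective (hf.1 ((hg s).trans h.symm))⟩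

/-! ### Adding the vertices one at a time -/

/-- The tokens `X`, coloured by `α`, can be given traces on `U` that look like the traces on `U` of
the hyperedges of `lam K_n^h`, where `n = |V|`: a set `S ⊆ U` that misses `j` of the `h` vertices is
a trace `lam * (n - |U|).choose j` times, and the colour class `i` has degree `r i` on `U`. -/
theorem exists_traces {V X I : Type*} [Fintype V] [DecidableEq V] [Fintype X] [Fintype I]
    [DecidableEq I] (h lam : ℕ) (α : X → I) (r : I → ℕ)
    (hα : ∀ i, h * Fintype.card {x // α x = i} = r i * Fintype.card V)
    (hX : Fintype.card X = lam * (Fintype.card V).choose h) (U : Finset V) :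
    ∃ T : X → Finset V, (∀ x, T x ⊆ U) ∧ (∀ x, (T x).card ≤ h) ∧
      (∀ S ⊆ U, ∀ j, S.card + j = h →
        Fintype.card {x // T x = S} = lam * (Fintype.card V - U.card).choose j) ∧
      ∀ i, ∀ v ∈ U, Fintype.card {x // α x = i ∧ v ∈ T x} = r i := by
  classical
  simp only [Fintype.card_subtype] at hα ⊢
  induction U using Finset.induction_on with
  | empty =>
    refine ⟨fun _ => ∅, by simp, by simp, ?_, by simp⟩
    intro S hS j hj
    obtain rfl := Finset.subset_empty.1 hS
    obtain rfl : j = h := by simpa using hj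
    simpa using hX
  | insert v U hv ih =>
    obtain ⟨T, hTU, hTh, hTS, hTr⟩ := ih
    have hUlt : U.card < Fintype.card V := Finset.card_lt_univ_of_notMem hv
    obtain ⟨N, hN⟩ : ∃ N, Fintype.card V - U.card = N + 1 := ⟨_, (Nat.succ_pred (by omega)).symm⟩
    have hN' : Fintype.card V - (insert v U).card = N := by
      rw [Finset.card_insert_of_notMem hv]; omega
    have hVN : (Fintype.card V : ℚ) = U.card + (N + 1) := by
      exact_mod_cast (by omega : Fintype.card V = U.card + (N + 1))
    rw [hN] at hTS
    rw [hN']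
    -- The fraction of `v` that goes to `x`: the expected share if the `h - |T x|` missing vertices
    -- of `x` were chosen uniformly among the `N + 1` vertices outside `U`.
    let w : X → ℚ := fun x => (h - (T x).card) / (N + 1)
    -- The number of hyperedges with trace `S` on `U` that contain `v`.
    let b : Finset V → ℕ := fun S =>
      if S ⊆ U ∧ S.card < h then lam * N.choose (h - S.card - 1) else 0
    obtain ⟨F, hFα, hFT⟩ := exists_finset_card_fibers_eq α T w
      (fun x => div_nonneg (sub_nonneg.2 (by exact_mod_cast hTh x)) (by positivity))
      (by
        intro x
        -- `T x` occurs as a trace, so the binomial coefficient that counts it is nonzero.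
        have h1 := hTS (T x) (hTU x) (h - (T x).card) (by have := hTh x; omega)
        have h2 : 0 < (Finset.univ.filter fun y => T y = T x).card :=
          Finset.card_pos.2 ⟨x, by simp⟩
        have h3 : h - (T x).card ≤ N + 1 := by
          by_contra hlt
          rw [Nat.choose_eq_zero_of_lt (not_le.1 hlt)] at h1
          omega
        have h4 : (h : ℚ) ≤ N + 1 + (T x).card := by
          exact_mod_cast (by omega : h ≤ N + 1 + (T x).card)
        rw [div_le_one (by positivity)]
        linarith)
      r b
      (by
        intro i
        have h1 : ∑ x with α x = i, ((T x).card : ℚ) = U.card * r i := by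
          have h2 : ∑ x with α x = i, (T x).card = ∑ u ∈ U, r i := by
            have := Finset.sum_card_bipartiteAbove_eq_sum_card_bipartiteBelow
              (s := Finset.univ.filter fun x => α x = i) (t := U) (fun x u => u ∈ T x)
            refine Eq.trans ?_ (this.trans (Finset.sum_congr rfl fun u hu => ?_))
            · refine Finset.sum_congr rfl fun x _ => congrArg _ ?_
              ext u
              simp only [Finset.mem_bipartiteAbove]
              exact ⟨fun hu => ⟨hTU x hu, hu⟩, fun hu => hu.2⟩
            · rw [← hTr i u hu, Finset.bipartiteBelow, Finset.filter_filter]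
          have h3 := congrArg (Nat.cast : ℕ → ℚ) h2
          push_cast at h3
          simpa using h3
        have h4 : (h : ℚ) * (Finset.univ.filter fun x => α x = i).card
            = r i * Fintype.card V := by exact_mod_cast hα i
        simp only [w]
        rw [← Finset.sum_div, Finset.sum_sub_distrib, h1, Finset.sum_const, nsmul_eq_mul,
          div_eq_iff (by positivity)]
        rw [hVN] at h4
        linarith)
      (by
        intro S
        have h1 : ∑ x with T x = S, w x
            = (Finset.univ.filter fun x => T x = S).card * ((h - S.card : ℚ) / (N + 1)) := by
          rw [← nsmul_eq_mul, ← Finset.sum_const]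
          refine Finset.sum_congr rfl fun x hx => ?_
          rw [← (Finset.mem_filter.1 hx).2]
        rw [h1]
        by_cases hSU : S ⊆ U
        · rcases lt_trichotomy S.card h with hlt | heq | hgt
          · obtain ⟨j, rfl⟩ : ∃ j, h = S.card + (j + 1) := ⟨h - S.card - 1, by omega⟩
            have h2 := Nat.add_one_mul_choose_eq N j
            have h3 : ((N : ℚ) + 1) * N.choose j = (N + 1).choose (j + 1) * (j + 1) := by
              exact_mod_cast h2
            have h4 : b S = lam * N.choose j := by
              simp only [b, if_pos (And.intro hSU hlt)]
              congr 2
              omega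
            rw [hTS S hSU (j + 1) rfl, h4, ← mul_div_assoc, div_eq_iff (by positivity)]
            push_cast
            linear_combination (-(lam : ℚ)) * h3
          · simp [b, heq]
          · have : (Finset.univ.filter fun x => T x = S) = ∅ := by
              refine Finset.filter_eq_empty_iff.2 fun x _ hx => ?_
              have := hTh x
              rw [hx] at this
              omega
            simp [this, b, hgt.not_gt]
        · have : (Finset.univ.filter fun x => T x = S) = ∅ :=
            Finset.filter_eq_empty_iff.2 fun x _ hx => hSU (hx ▸ hTU x)
          simp [this, b, hSU])
    have hvT : ∀ x, v ∉ T x := fun x hx => hv (hTU x hx)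
    refine ⟨fun x => if x ∈ F then insert v (T x) else T x, ?_, ?_, ?_, ?_⟩
    · intro x
      dsimp only
      split_ifs
      · exact Finset.insert_subset_insert v (hTU x)
      · exact (hTU x).trans (Finset.subset_insert v U)
    · intro x
      dsimp only
      split_ifs with hx
      · rw [Finset.card_insert_of_notMem (hvT x)]
        by_contra hlt
        have h1 := hFT (T x)
        simp only [b, if_neg (fun hh : T x ⊆ U ∧ (T x).card < h => hlt hh.2)] at h1
        exact Finset.filter_eq_empty_iff.1 (Finset.card_eq_zero.1 h1) hx rfl
      · exact hTh x
    · intro S hS j hj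
      by_cases hvS : v ∈ S
      · have h1 : (Finset.univ.filter fun x => (if x ∈ F then insert v (T x) else T x) = S)
            = F.filter fun x => T x = S.erase v := by
          ext x
          simp only [Finset.mem_filter, Finset.mem_univ, true_and]
          split_ifs with hx
          · simp only [hx, true_and]
            constructor
            · rintro rfl
              rw [Finset.erase_insert (hvT x)]
            · rintro h2
              rw [h2, Finset.insert_erase hvS]
          · simp only [hx, false_and, iff_false]
            rintro rfl
            exact hvT x hvS
        have h2 := Finset.card_erase_add_one hvS
        rw [h1, hFT]
        simp only [b]
        rw [if_pos ⟨Finset.subset_insert_iff.1 hS, by omega⟩]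
        congr 2
        omega
      · have hSU : S ⊆ U := (Finset.subset_insert_iff_of_notMem hvS).1 hS
        have h1 : (Finset.univ.filter fun x => (if x ∈ F then insert v (T x) else T x) = S)
            = (Finset.univ.filter fun x => T x = S) \ F.filter fun x => T x = S := by
          ext x
          simp only [Finset.mem_filter, Finset.mem_univ, true_and, Finset.mem_sdiff]
          split_ifs with hx
          · simp only [hx, true_and, and_not_self_iff, iff_false]
            rintro rfl
            exact hvS (Finset.mem_insert_self _ _)
          · simp [hx]
        rw [h1, Finset.card_sdiff_of_subset
          (Finset.filter_subset_filter _ (Finset.subset_univ F)), hFT, hTS S hSU j hj]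
        simp only [b]
        rcases j with _ | j
        · rw [if_neg (by omega)]
          simp
        · rw [if_pos ⟨hSU, by omega⟩, show h - S.card - 1 = j by omega,
            Nat.choose_succ_succ, mul_add, Nat.add_sub_cancel_left]
    · intro i u hu
      rcases Finset.mem_insert.1 hu with rfl | huU
      · rw [← hFα i]
        congr 1
        ext x
        simp only [Finset.mem_filter, Finset.mem_univ, true_and]
        split_ifs with hx <;> simp [hx, hvT x]
      · rw [← hTr i u huU]
        have huv : u ≠ v := fun h => hv (h ▸ huU)
        congr 1
        ext x
        simp only [Finset.mem_filter, Finset.mem_univ, true_and]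
        split_ifs with hx <;> simp [huv]

/-! ### Factorizations as colourings -/

namespace HingeHypergraph

/-- In a uniform hypergraph no hyperedge has two hinges at the same vertex, so degrees count
hyperedges. -/
theorem degree_spanningSub_multiple {V E H : Type*} [Finite V] [Finite E] [Finite H]
    {G : HingeHypergraph V E H} {h : ℕ} (hG : G.IsUniform h) (lam : ℕ) (S : Set (E × Fin lam))
    (v : V) : ((G.multiple lam).spanningSub S).degree v
      = {p | p ∈ S ∧ v ∈ G.edgeVertices p.1}.ncard := by
  have hinj : ∀ e, Set.InjOn G.ψ (G.hinges e) := fun e =>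
    Set.injOn_of_ncard_image_eq ((hG e).1.trans (hG e).2.symm)
  refine Set.ncard_congr (fun q _ => (G.multiple lam).φ q.1) ?_ ?_ ?_
  · rintro ⟨⟨x, j⟩, hS⟩ hv
    exact ⟨hS, x, rfl, hv⟩
  · rintro ⟨⟨x, j⟩, hS⟩ ⟨⟨y, l⟩, hS'⟩ hx hy hxy
    have h1 : G.φ x = G.φ y := congrArg Prod.fst hxy
    have h2 : j = l := congrArg Prod.snd hxy
    have h3 : G.ψ x = G.ψ y := Eq.trans (show G.ψ x = v from hx) (show G.ψ y = v from hy).symm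
    obtain rfl : x = y := hinj (G.φ y) h1 rfl h3
    subst h2
    rfl
  · rintro ⟨e, j⟩ ⟨hS, x, rfl, hv⟩
    exact ⟨⟨(x, j), hS⟩, hv, rfl⟩

/-- A factorization of a multiple of a uniform hypergraph, expressed as a colouring of its
hyperedges. -/
theorem isFactorizable_multiple_iff {V E H : Type*} [Finite V] [Finite E] [Finite H]
    {G : HingeHypergraph V E H} {h : ℕ} (hG : G.IsUniform h) (lam : ℕ) {k : ℕ} (r : Fin k → ℕ) :
    (G.multiple lam).IsFactorizable r ↔
      ∃ c : E × Fin lam → Fin k, ∀ i v, {p | c p = i ∧ v ∈ G.edgeVertices p.1}.ncard = r i := by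
  constructor
  · rintro ⟨P, hd, hu, hP⟩
    have hc : ∀ p, ∃ i, p ∈ P i := fun p => Set.mem_iUnion.1 (hu ▸ Set.mem_univ p)
    choose c hc using hc
    have hcP : ∀ i p, c p = i ↔ p ∈ P i := by
      refine fun i p => ⟨fun h => h ▸ hc p, fun hp => ?_⟩
      by_contra hne
      exact Set.disjoint_left.1 (hd hne) (hc p) hp
    refine ⟨c, fun i v => ?_⟩
    simp only [hcP]
    exact (degree_spanningSub_multiple hG lam (P i) v).symm.trans (hP i v)
  · rintro ⟨c, hc⟩
    refine ⟨fun i => {p | c p = i}, fun i j hij => ?_, ?_, fun i v => ?_⟩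
    · exact Set.disjoint_left.2 fun p hp hq => hij (Eq.trans (Eq.symm hp) hq)
    · exact Set.eq_univ_of_forall fun p => Set.mem_iUnion.2 ⟨c p, rfl⟩
    · exact (degree_spanningSub_multiple hG lam _ v).trans (hc i v)

/-- The hyperedges of a complete `h`-uniform hypergraph are the `h`-sets of vertices. -/
theorem IsComplete.exists_equiv {V E H : Type*} [Fintype V] [Finite E] [Finite H]
    {G : HingeHypergraph V E H} {h n : ℕ} (hG : G.IsComplete h n) :
    ∃ f : E ≃ {S : Finset V // S.card = h}, ∀ e v, v ∈ (f e).1 ↔ v ∈ G.edgeVertices e := by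
  classical
  refine ⟨Equiv.ofBijective (fun e => ⟨(G.edgeVertices e).toFinset, ?_⟩) ⟨?_, ?_⟩, ?_⟩
  · rw [← Set.ncard_eq_toFinset_card', (hG.1 e).1]
  · intro e e' h
    have h' : G.edgeVertices e = G.edgeVertices e' := by simpa using h
    exact (hG.2.2 _ (hG.1 e').1).unique h' rfl
  · rintro ⟨S, hS⟩
    obtain ⟨e, he, -⟩ := hG.2.2 (S : Set V) (by rw [Set.ncard_coe_finset, hS])
    exact ⟨e, Subtype.ext (by simp [he])⟩
  · exact fun e v => Set.mem_toFinset

end HingeHypergraph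

/-! ### Counting -/

/-- Double counting of the incident pairs in a colour class of constant degree `d`. -/
theorem card_mul_of_regular {V B Q : Type*} [Fintype V] [Fintype Q] [DecidableEq V] [DecidableEq B]
    {h : ℕ} (c : Q → B) (t : Q → Finset V) (ht : ∀ q, (t q).card = h) (i : B) {d : ℕ}
    (hd : ∀ v, Fintype.card {q // c q = i ∧ v ∈ t q} = d) :
    h * Fintype.card {q // c q = i} = d * Fintype.card V := by
  simp only [Fintype.card_subtype] at *
  have := Finset.sum_card_bipartiteAbove_eq_sum_card_bipartiteBelow
    (s := Finset.univ.filter fun q => c q = i) (t := Finset.univ) (fun q v => v ∈ t q)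
  simp only [Finset.bipartiteAbove, Finset.bipartiteBelow, Finset.filter_filter, hd,
    Finset.filter_univ_mem, ht, Finset.sum_const, Finset.card_univ, smul_eq_mul] at this
  rw [mul_comm h, this, mul_comm]

theorem card_subtype_mem {V : Type*} [Fintype V] [DecidableEq V] (h : ℕ) (v : V) :
    Fintype.card {S : {S : Finset V // S.card = h + 1} // v ∈ S.1}
      = (Fintype.card V - 1).choose h := by
  have h1 : Fintype.card {S : {S : Finset V // S.card = h + 1} // v ∈ S.1}
      = ((Finset.univ.erase v).powersetCard h).card := by
    rw [← Finset.card_univ]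
    refine Finset.card_bij' (fun S _ => S.1.1.erase v)
      (fun S hS => ⟨⟨insert v S, ?_⟩, Finset.mem_insert_self _ _⟩) ?_ ?_ ?_ ?_
    · rw [Finset.mem_powersetCard] at hS
      rw [Finset.card_insert_of_notMem fun hv => Finset.notMem_erase v _ (hS.1 hv), hS.2]
    · rintro ⟨⟨S, hS⟩, hv⟩ -
      rw [Finset.mem_powersetCard]
      exact ⟨Finset.erase_subset_erase _ (Finset.subset_univ _),
        by rw [Finset.card_erase_of_mem hv, hS, Nat.add_sub_cancel]⟩
    · intro S _
      exact Finset.mem_univ _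
    · rintro ⟨⟨S, hS⟩, hv⟩ -
      simp [Finset.insert_erase hv]
    · intro S hS
      rw [Finset.mem_powersetCard] at hS
      exact Finset.erase_insert fun hv => Finset.notMem_erase v _ (hS.1 hv)
  rw [h1, Finset.card_powersetCard, Finset.card_erase_of_mem (Finset.mem_univ v),
    Finset.card_univ]

theorem exists_equiv_of_card_fibers {X Y : Type*} [Fintype X] [DecidableEq Y] (lam : ℕ) (t : X → Y)
    (ht : ∀ y, Fintype.card {x // t x = y} = lam) :
    ∃ g : Y × Fin lam ≃ X, ∀ p, t (g p) = p.1 :=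
  ⟨(Equiv.sigmaEquivProd Y (Fin lam)).symm.trans
    ((Equiv.sigmaCongrRight fun y => (Fintype.equivFinOfCardEq (ht y)).symm).trans
      (Equiv.sigmaFiberEquiv t)), fun p => ((Fintype.equivFinOfCardEq (ht p.1)).symm p.2).2⟩

/-! ### The characterization of factorizations -/

theorem theorem4p1 {V E H : Type*} [Finite V] [Finite E] [Finite H]
    (K : HingeHypergraph V E H) (n : ℕ) (hn : 3 ≤ n) (hK : K.IsComplete 3 n)
    (lam : ℕ) (hlam : 1 ≤ lam) (k : ℕ) (r : Fin k → ℕ) (hr : ∀ i, 0 < r i) :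
    (K.multiple lam).IsFactorizable r ↔
      (∀ i, 3 ∣ r i * n) ∧ ∑ i, r i = lam * (n - 1).choose 2 := by
  classical
  have := Fintype.ofFinite V
  have := Fintype.ofFinite E
  rw [HingeHypergraph.isFactorizable_multiple_iff hK.1]
  obtain ⟨f, hf⟩ := hK.exists_equiv
  have hV : Fintype.card V = n := by rw [← Nat.card_eq_fintype_card, hK.2.1]
  simp only [← hf, ← Nat.card_coe_set_eq, Set.coe_ofPred, Nat.card_eq_fintype_card]
  constructor
  · rintro ⟨c, hc⟩
    constructor
    · intro i
      rw [← hV, ← card_mul_of_regular c (fun p => (f p.1).1) (fun p => (f p.1).2) i (hc i)]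
      exact dvd_mul_right _ _
    · obtain ⟨v⟩ : Nonempty V := Fintype.card_pos_iff.1 (by omega)
      have e1 : {p : E × Fin lam // v ∈ (f p.1).1}
          ≃ {S : {S : Finset V // S.card = 2 + 1} // v ∈ S.1} × Fin lam :=
        (Equiv.subtypeEquiv (Equiv.prodCongr f (Equiv.refl _)) (fun p => by rfl)).trans
          (Equiv.prodSubtypeFstEquivSubtypeProd
            (p := fun S : {S : Finset V // S.card = 2 + 1} => v ∈ S.1))
      have h1 := Fintype.card_congr e1
      rw [Fintype.card_prod, card_subtype_mem, Fintype.card_fin, hV, mul_comm] at h1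
      rw [← h1, Fintype.card_subtype,
        Finset.card_eq_sum_card_fiberwise (f := c) (t := Finset.univ) fun _ _ => Finset.mem_univ _]
      refine Finset.sum_congr rfl fun i _ => ?_
      rw [← hc i v, Fintype.card_subtype, Finset.filter_filter]
      simp only [and_comm]
  · rintro ⟨hdvd, hsum⟩
    have h3 : ∀ i, 3 * (r i * n / 3) = r i * n := fun i => Nat.mul_div_cancel' (hdvd i)
    obtain ⟨T, -, hTh, hTS, hTr⟩ := exists_traces (V := V) (X := Σ i, Fin (r i * n / 3)) 3 lam
      Sigma.fst r
      (by
        intro i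
        rw [hV, Fintype.card_congr (Equiv.sigmaSubtype i), Fintype.card_fin, h3])
      (by
        rw [hV, Fintype.card_sigma]
        simp only [Fintype.card_fin]
        refine Nat.eq_of_mul_eq_mul_left (n := 3) (by norm_num) ?_
        rw [Finset.mul_sum, Finset.sum_congr rfl fun i _ => h3 i, ← Finset.sum_mul, hsum]
        obtain ⟨m, rfl⟩ : ∃ m, n = m + 1 := ⟨n - 1, by omega⟩
        have := Nat.add_one_mul_choose_eq m 2
        simp only [Nat.add_sub_cancel]
        linear_combination lam * this)
      Finset.univ
    rw [Finset.card_univ, Nat.sub_self] at hTS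
    -- With no vertex left, a trace of fewer than three vertices would occur `lam * choose 0 j = 0`
    -- times for some `j > 0`.
    have hT3 : ∀ x, (T x).card = 3 := by
      intro x
      have h1 : 0 < Fintype.card {y // T y = T x} := Fintype.card_pos_iff.2 ⟨⟨x, rfl⟩⟩
      by_contra hne
      rw [hTS (T x) (Finset.subset_univ _) (3 - (T x).card) (by have := hTh x; omega),
        Nat.choose_eq_zero_of_lt (by have := hTh x; omega)] at h1
      omega
    obtain ⟨g, hg⟩ := exists_equiv_of_card_fibers lam
      (fun x => (⟨T x, hT3 x⟩ : {S : Finset V // S.card = 3})) (by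
        rintro ⟨S, hS⟩
        simp only [Subtype.mk.injEq]
        rw [hTS S (Finset.subset_univ S) 0 hS, Nat.choose_zero_right, mul_one])
    -- Identify the hyperedges of `lam K_n^3` with the tokens, and transport the colouring.
    let e := (Equiv.prodCongr f (Equiv.refl (Fin lam))).trans g
    refine ⟨fun p => (e p).1, fun i v => ?_⟩
    rw [← hTr i v (Finset.mem_univ v)]
    refine Fintype.card_congr (Equiv.subtypeEquiv e fun p => ?_)
    have h1 : T (e p) = (f p.1).1 := congrArg Subtype.val (hg (f p.1, p.2))
    rw [h1]
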